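/- **Global Progress for domain-aware session-typed processes.** *Syntax.* Fix sets of domain tags $w$ and of labels $l$. A domain $\omega$ is a domain tag or a domain variable $\alpha$. Session types are $$A,B,C ::= \mathbf 1 \mid A\multimap B \mid A\otimes B \mid \&\{l:A_l\}_{l\in I} \mid \oplus\{l:A_l\}_{l\in I} \mid {!}A \mid @_\omega A \mid \forall\alpha.A \mid \exists\alpha.A \mid {\downarrow}\alpha.A,$$ and processes are $$P,Q,R ::= \mathbf 0 \mid P\,|\,Q \mid (\nu y)P \mid x\langle y\rangle.P \mid x(y).P \mid {!}x(y).P \mid [x\leftrightarrow y] \mid x\triangleright\{l:P_l\}_{l\in I} \mid x\triangleleft l;P \mid x\langle y@\omega\rangle.P \mid x(y@\omega).P \mid x\langle\omega\rangle.P \mid x(\alpha).P$$ with $I$ a finite set of labels. The name $y$ is bound in $(\nu y)P$, $x(y).P$, ${!}x(y).P$ and $x(y@\omega).P$, and $\alpha$ is bound in $x(\alpha).P$, $\forall\alpha.A$, $\exists\alpha.A$ and ${\downarrow}\alpha.A$; everything is taken up to renaming of bound names and variables, and substitution is capture-avoiding. Write $\overline{x}\langle y\rangle.P=(\nu y)x\langle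 y\rangle.P$ and $\overline{x}\langle y@\omega\rangle.P=(\nu y)x\langle y@\omega\rangle.P$ with $y\ne x$. *Structural congruence* $\equiv$ is the least congruence with $P|\mathbf 0\equiv P$, $(\nu x)\mathbf 0\equiv\mathbf 0$, $[x\leftrightarrow y]\equiv[y\leftrightarrow x]$, $P|Q\equiv Q|P$, $P|(Q|R)\equiv(P|Q)|R$, $(\nu x)(\nu y)P\equiv(\nu y)(\nu x)P$, and $P|(\nu x)Q\equiv(\nu x)(P|Q)$ for $x\notin\mathrm{fn}(P)$. *Reduction* $\to$ is the least relation that is closed under $\equiv$ on both sides, under $P\,|\,-$ and under $(\nu y)-$, and that contains $$\begin{array}{l} x\langle y\rangle.Q\,|\,x(z).P\to Q\,|\,P\{y/z\},\\ x\langle y\rangle.Q\,|\,{!}x(z).P\to Q\,|\,P\{y/z\}\,|\,{!}x(z).P,\\ x\langle y@\omega\rangle.P\,|\,x(z@\omega').Q\to P\,|\,Q\{y/z\},\\ x\langle\omega\rangle.P\,|\,x(\alpha).Q\to P\,|\,Q\{\omega/\alpha\},\\ (\nu x)([x\leftrightarrow y]\,|\,P)\to P\{y/x\}\quad(y\neq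 x),\\ x\triangleleft l;P\,|\,x\triangleright\{l':Q_{l'}\}_{l'\in I}\to P\,|\,Q_l\quad(l\in I). \end{array}$$ *Liveness.* A process $P$ is live, $live(P)$, if $P\equiv(\nu\tilde n)(\pi.Q\,|\,R)$ for some finite sequence of names $\tilde n$, some process $R$ and some non-replicated guarded process $\pi.Q$, i.e. a process of one of the forms $x\langle y\rangle.Q$, $x(y).Q$, $x\triangleright\{l:Q_l\}_{l\in I}$, $x\triangleleft l;Q$, $x\langle y@\omega\rangle.Q$, $x(y@\omega).Q$, $x\langle\omega\rangle.Q$, $x(\alpha).Q$. *Typing.* $\Omega$ is a finite collection of hypotheses $\omega_1\prec\omega_2$; $\Omega\vdash\omega_1\prec\omega_2$ holds iff $\omega_1\prec\omega_2$ is in $\Omega$, and $\prec^*$ is the reflexive transitive closure of $\prec$. $\Gamma$ (unrestricted) and $\Delta$ (linear) are finite collections of assignments $x{:}A[\omega]$, and $\Omega\vdash\omega\prec^*\Delta$ means $\Omega\vdash\omega\prec^*\omega'$ for all $x{:}A[\omega']$ in $\Delta$. The empty environment is written $\cdot$. The judgment $\Omega;\Gamma;\Delta\vdash P::z{:}C[\omega]$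 is closed under $\equiv$ on $P$ and is generated by the following rules, where all names declared in a sequent are distinct and names and domain variables that are bound in the process of a conclusion are fresh for the rest of that conclusion ($\Omega$ is omitted where it does not change, and premises are written to the left of $\Rightarrow$): - id: $\Gamma;x{:}A[\omega]\vdash[x\leftrightarrow z]::z{:}A[\omega]$. - $\mathbf 1$R: $\Gamma;\cdot\vdash\mathbf 0::z{:}\mathbf 1[\omega]$. - $\mathbf 1$L: $\Gamma;\Delta\vdash P::z{:}C[\omega_1]\Rightarrow\Gamma;\Delta,x{:}\mathbf 1[\omega_2]\vdash P::z{:}C[\omega_1]$. - $\multimap$R: $\Gamma;\Delta,y{:}A[\omega]\vdash P::z{:}B[\omega]\Rightarrow\Gamma;\Delta\vdash z(y).P::z{:}A\multimap B[\omega]$. - $\multimap$L: $\Gamma;\Delta_1\vdash P::y{:}A[\omega_2]$ and $\Gamma;\Delta_2,x{:}B[\omega_2]\vdash Q::z{:}C[\omega_1]$ $\Rightarrow$ $\Gamma;\Delta_1,\Delta_2,x{:}A\multimap B[\omega_2]\vdash\overline x\langle y\rangle.(P|Q)::z{:}C[\omega_1]$. - $\otimes$R: $\Gamma;\Delta_1\vdash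 P::y{:}A[\omega]$ and $\Gamma;\Delta_2\vdash Q::z{:}B[\omega]$ $\Rightarrow$ $\Gamma;\Delta_1,\Delta_2\vdash\overline z\langle y\rangle.(P|Q)::z{:}A\otimes B[\omega]$. - $\otimes$L: $\Gamma;\Delta,y{:}A[\omega_2],x{:}B[\omega_2]\vdash P::z{:}C[\omega_1]\Rightarrow\Gamma;\Delta,x{:}A\otimes B[\omega_2]\vdash x(y).P::z{:}C[\omega_1]$. - $\&$R: $\Gamma;\Delta\vdash P_l::z{:}A_l[\omega]$ for all $l\in I$ $\Rightarrow$ $\Gamma;\Delta\vdash z\triangleright\{l:P_l\}_{l\in I}::z{:}\&\{l:A_l\}_{l\in I}[\omega]$. - $\&$L$_1$: $\Gamma;\Delta,x{:}A[\omega_2]\vdash P::z{:}C[\omega_1]\Rightarrow\Gamma;\Delta,x{:}\&\{l:A\}[\omega_2]\vdash x\triangleleft l;P::z{:}C[\omega_1]$. - $\&$L$_2$: $\Gamma;\Delta,x{:}\&\{l:A_l\}_{l\in I}[\omega_2]\vdash P::z{:}C[\omega_1]$ and $k\notin I$ $\Rightarrow$ $\Gamma;\Delta,x{:}\&\{l:A_l\}_{l\in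 I\cup\{k\}}[\omega_2]\vdash P::z{:}C[\omega_1]$. - $\oplus$R$_1$: $\Gamma;\Delta\vdash P::z{:}A[\omega]\Rightarrow\Gamma;\Delta\vdash z\triangleleft l;P::z{:}\oplus\{l:A\}[\omega]$. - $\oplus$R$_2$: $\Gamma;\Delta\vdash P::z{:}\oplus\{l:A_l\}_{l\in I}[\omega]$ and $k\notin I$ $\Rightarrow$ $\Gamma;\Delta\vdash P::z{:}\oplus\{l:A_l\}_{l\in I\cup\{k\}}[\omega]$. - $\oplus$L: $\Gamma;\Delta,x{:}A_l[\omega_2]\vdash Q_l::z{:}C[\omega_1]$ for all $l\in I$ $\Rightarrow$ $\Gamma;\Delta,x{:}\oplus\{l:A_l\}_{l\in I}[\omega_2]\vdash x\triangleright\{l:Q_l\}_{l\in I}::z{:}C[\omega_1]$. - $!$R: $\Gamma;\cdot\vdash Q::y{:}A[\omega]\Rightarrow\Gamma;\cdot\vdash\overline z\langle u\rangle.{!}u(y).Q::z{:}{!}A[\omega]$. - $!$L: $\Gamma,u{:}A[\omega_2];\Delta\vdash P::z{:}C[\omega_1]\Rightarrow\Gamma;\Delta,x{:}{!}A[\omega_2]\vdash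 x(u).P::z{:}C[\omega_1]$. - $@$R: $\Omega\vdash\omega_1\prec\omega_2$, $\Omega\vdash\omega_2\prec^*\Delta$ and $\Gamma;\Delta\vdash P::y{:}A[\omega_2]$ $\Rightarrow$ $\Gamma;\Delta\vdash\overline z\langle y@\omega_2\rangle.P::z{:}@_{\omega_2}A[\omega_1]$. - $@$L: $\Omega,\omega_2\prec\omega_3;\Gamma;\Delta,y{:}A[\omega_3]\vdash P::z{:}C[\omega_1]$ $\Rightarrow$ $\Omega;\Gamma;\Delta,x{:}@_{\omega_3}A[\omega_2]\vdash x(y@\omega_3).P::z{:}C[\omega_1]$. - $\forall$R: $\Omega,\omega_1\prec\alpha;\Gamma;\Delta\vdash P::z{:}A[\omega_1]$ with $\alpha$ fresh $\Rightarrow$ $\Omega;\Gamma;\Delta\vdash z(\alpha).P::z{:}\forall\alpha.A[\omega_1]$. - $\forall$L: $\Omega\vdash\omega_2\prec\omega_3$ and $\Gamma;\Delta,x{:}A\{\omega_3/\alpha\}[\omega_2]\vdash Q::z{:}C[\omega_1]$ $\Rightarrow$ $\Gamma;\Delta,x{:}\forall\alpha.A[\omega_2]\vdash x\langle\omega_3\rangle.Q::z{:}C[\omega_1]$.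 - $\exists$R: $\Omega\vdash\omega_1\prec\omega_2$ and $\Gamma;\Delta\vdash P::z{:}A\{\omega_2/\alpha\}[\omega_1]$ $\Rightarrow$ $\Gamma;\Delta\vdash z\langle\omega_2\rangle.P::z{:}\exists\alpha.A[\omega_1]$. - $\exists$L: $\Omega,\omega_2\prec\alpha;\Gamma;\Delta,x{:}A[\omega_2]\vdash Q::z{:}C[\omega_1]$ with $\alpha$ fresh $\Rightarrow$ $\Omega;\Gamma;\Delta,x{:}\exists\alpha.A[\omega_2]\vdash x(\alpha).Q::z{:}C[\omega_1]$. - $\downarrow$R: $\Gamma;\Delta\vdash P::z{:}A\{\omega/\alpha\}[\omega]\Rightarrow\Gamma;\Delta\vdash P::z{:}{\downarrow}\alpha.A[\omega]$. - $\downarrow$L: $\Gamma;\Delta,x{:}A\{\omega/\alpha\}[\omega]\vdash P::z{:}C[\omega_1]\Rightarrow\Gamma;\Delta,x{:}{\downarrow}\alpha.A[\omega]\vdash P::z{:}C[\omega_1]$. - copy: $\Omega\vdash\omega_1\prec^*\omega_2$ and $\Gamma,u{:}A[\omega_2];\Delta,y{:}A[\omega_2]\vdash P::z{:}C[\omega_1]$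 $\Rightarrow$ $\Gamma,u{:}A[\omega_2];\Delta\vdash\overline u\langle y\rangle.P::z{:}C[\omega_1]$. - cut: $\Omega\vdash\omega_1\prec^*\omega_2$, $\Omega\vdash\omega_2\prec^*\Delta_1$, $\Gamma;\Delta_1\vdash P::x{:}A[\omega_2]$ and $\Gamma;\Delta_2,x{:}A[\omega_2]\vdash Q::z{:}C[\omega_1]$ $\Rightarrow$ $\Gamma;\Delta_1,\Delta_2\vdash(\nu x)(P|Q)::z{:}C[\omega_1]$. - cut$^!$: $\Gamma;\cdot\vdash P::x{:}A[\omega_1]$ and $\Gamma,u{:}A[\omega_1];\Delta\vdash Q::z{:}C[\omega_2]$ $\Rightarrow$ $\Gamma;\Delta\vdash(\nu u)({!}u(x).P\,|\,Q)::z{:}C[\omega_2]$. **Theorem (Global Progress).** If $\Omega;\cdot;\cdot\vdash P::x{:}\mathbf 1[\omega]$ and $live(P)$, then there is a process $Q$ with $P\to Q$. -/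

import Mathlib

/-!
Domain-aware session-typed processes.

Binding is represented by well-scoped de Bruijn indices, so processes and types that differ only in
the choice of bound names or bound domain variables are literally equal. An object with scope
`n d` may mention `n` channel names (`Fin n`) and `d` domain variables (`Fin d`); a binder adds
index `0` and shifts the others by `Fin.succ`.
-/

universe u v

namespace DomainSession

/-- A domain: a domain tag, or one of the `d` domain variables in scope. -/
inductive Dom (W : Type u) (d : ℕ) : Type u
  | tag (w : W) : Dom W d
  | var (i : Fin d) : Dom W d

/-- Substitution of domains for domain variables. -/
def Dom.subst {W : Type u} {d e : ℕ} (σ : Fin d → Dom W e) : Dom W d → Dom W e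
  | .tag w => .tag w
  | .var i => σ i

/-- Passing to a scope with one more domain variable. -/
def Dom.shift {W : Type u} {d : ℕ} (ω : Dom W d) : Dom W (d + 1) :=
  ω.subst (fun i => .var i.succ)

/-- Extension of a domain substitution under a binder. -/
def liftD {W : Type u} {d e : ℕ} (σ : Fin d → Dom W e) : Fin (d + 1) → Dom W (e + 1) :=
  Fin.cons (.var 0) (fun i => (σ i).shift)

/-- The domain substitution `{ω/α}`, where `α` is the innermost domain variable. -/
def instD {W : Type u} {d : ℕ} (ω : Dom W d) : Fin (d + 1) → Dom W d :=
  Fin.cons ω (fun i => .var i)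

/-- Extension of a renaming of channel names under a binder. -/
def liftN {n m : ℕ} (ρ : Fin n → Fin m) : Fin (n + 1) → Fin (m + 1) :=
  Fin.cons 0 (fun i => (ρ i).succ)

/-- The name substitution `{y/x}`, where `x` is the innermost name. -/
def instN {n : ℕ} (y : Fin n) : Fin (n + 1) → Fin n :=
  Fin.cons y (fun i => i)

/-- Session types over domain tags `W` and labels `L`:
`𝟏`, `A ⊸ B`, `A ⊗ B`, `&{l : A_l}_{l ∈ I}`, `⊕{l : A_l}_{l ∈ I}`, `!A`, `@_ω A`, `∀α.A`, `∃α.A`,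
`↓α.A`. -/
inductive Ty (W : Type u) (L : Type v) : ℕ → Type (max u v)
  | one {d : ℕ} : Ty W L d
  | lolli {d : ℕ} (A B : Ty W L d) : Ty W L d
  | tensor {d : ℕ} (A B : Ty W L d) : Ty W L d
  | amp {d : ℕ} (I : Finset L) (A : {l : L // l ∈ I} → Ty W L d) : Ty W L d
  | plus {d : ℕ} (I : Finset L) (A : {l : L // l ∈ I} → Ty W L d) : Ty W L d
  | bang {d : ℕ} (A : Ty W L d) : Ty W L d
  | at_ {d : ℕ} (ω : Dom W d) (A : Ty W L d) : Ty W L d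
  | all {d : ℕ} (A : Ty W L (d + 1)) : Ty W L d
  | ex {d : ℕ} (A : Ty W L (d + 1)) : Ty W L d
  | here {d : ℕ} (A : Ty W L (d + 1)) : Ty W L d

/-- Capture-avoiding substitution of domains in a type. -/
def Ty.subst {W : Type u} {L : Type v} {d : ℕ} :
    Ty W L d → {e : ℕ} → (Fin d → Dom W e) → Ty W L e
  | .one, _, _ => .one
  | .lolli A B, _, σ => .lolli (A.subst σ) (B.subst σ)
  | .tensor A B, _, σ => .tensor (A.subst σ) (B.subst σ)
  | .amp I A, _, σ => .amp I (fun l => (A l).subst σ)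
  | .plus I A, _, σ => .plus I (fun l => (A l).subst σ)
  | .bang A, _, σ => .bang (A.subst σ)
  | .at_ ω A, _, σ => .at_ (ω.subst σ) (A.subst σ)
  | .all A, _, σ => .all (A.subst (liftD σ))
  | .ex A, _, σ => .ex (A.subst (liftD σ))
  | .here A, _, σ => .here (A.subst (liftD σ))

/-- Passing to a scope with one more domain variable. -/
def Ty.shift {W : Type u} {L : Type v} {d : ℕ} (A : Ty W L d) : Ty W L (d + 1) :=
  A.subst (fun i => .var i.succ)

/-- `A{ω/α}` for the innermost domain variable `α` of `A`. -/
def Ty.inst {W : Type u} {L : Type v} {d : ℕ} (A : Ty W L (d + 1)) (ω : Dom W d) : Ty W L d :=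
  A.subst (instD ω)

/-- Processes. -/
inductive Proc (W : Type u) (L : Type v) : ℕ → ℕ → Type (max u v)
  /-- inaction `𝟎` -/
  | nil {n d : ℕ} : Proc W L n d
  /-- parallel composition `P | Q` -/
  | par {n d : ℕ} (P Q : Proc W L n d) : Proc W L n d
  /-- restriction `(νy)P`, binding a name -/
  | res {n d : ℕ} (P : Proc W L (n + 1) d) : Proc W L n d
  /-- output `x⟨y⟩.P` of the name `y` -/
  | out {n d : ℕ} (x y : Fin n) (P : Proc W L n d) : Proc W L n d
  /-- input `x(y).P`, binding a name -/
  | inp {n d : ℕ} (x : Fin n) (P : Proc W L (n + 1) d) : Proc W L n d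
  /-- replicated input `!x(y).P`, binding a name -/
  | rep {n d : ℕ} (x : Fin n) (P : Proc W L (n + 1) d) : Proc W L n d
  /-- forwarder `[x ↔ y]` -/
  | link {n d : ℕ} (x y : Fin n) : Proc W L n d
  /-- labelled choice `x ▹ {l : P_l}_{l ∈ I}` -/
  | case {n d : ℕ} (x : Fin n) (I : Finset L) (P : {l : L // l ∈ I} → Proc W L n d) : Proc W L n d
  /-- selection `x ◃ l; P` -/
  | sel {n d : ℕ} (x : Fin n) (l : L) (P : Proc W L n d) : Proc W L n d
  /-- migration output `x⟨y@ω⟩.P` -/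
  | outAt {n d : ℕ} (x y : Fin n) (ω : Dom W d) (P : Proc W L n d) : Proc W L n d
  /-- migration input `x(y@ω).P`, binding the name `y` -/
  | inpAt {n d : ℕ} (x : Fin n) (ω : Dom W d) (P : Proc W L (n + 1) d) : Proc W L n d
  /-- domain output `x⟨ω⟩.P` -/
  | outDom {n d : ℕ} (x : Fin n) (ω : Dom W d) (P : Proc W L n d) : Proc W L n d
  /-- domain input `x(α).P`, binding a domain variable -/
  | inpDom {n d : ℕ} (x : Fin n) (P : Proc W L n (d + 1)) : Proc W L n d

/-- Capture-avoiding renaming of the free names of a process. -/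
def Proc.rename {W : Type u} {L : Type v} {n d : ℕ} :
    Proc W L n d → {m : ℕ} → (Fin n → Fin m) → Proc W L m d
  | .nil, _, _ => .nil
  | .par P Q, _, ρ => .par (P.rename ρ) (Q.rename ρ)
  | .res P, _, ρ => .res (P.rename (liftN ρ))
  | .out x y P, _, ρ => .out (ρ x) (ρ y) (P.rename ρ)
  | .inp x P, _, ρ => .inp (ρ x) (P.rename (liftN ρ))
  | .rep x P, _, ρ => .rep (ρ x) (P.rename (liftN ρ))
  | .link x y, _, ρ => .link (ρ x) (ρ y)
  | .case x I P, _, ρ => .case (ρ x) I (fun l => (P l).rename ρ)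
  | .sel x l P, _, ρ => .sel (ρ x) l (P.rename ρ)
  | .outAt x y ω P, _, ρ => .outAt (ρ x) (ρ y) ω (P.rename ρ)
  | .inpAt x ω P, _, ρ => .inpAt (ρ x) ω (P.rename (liftN ρ))
  | .outDom x ω P, _, ρ => .outDom (ρ x) ω (P.rename ρ)
  | .inpDom x P, _, ρ => .inpDom (ρ x) (P.rename ρ)

/-- Capture-avoiding substitution of domains in a process. -/
def Proc.substD {W : Type u} {L : Type v} {n d : ℕ} :
    Proc W L n d → {e : ℕ} → (Fin d → Dom W e) → Proc W L n e
  | .nil, _, _ => .nil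
  | .par P Q, _, σ => .par (P.substD σ) (Q.substD σ)
  | .res P, _, σ => .res (P.substD σ)
  | .out x y P, _, σ => .out x y (P.substD σ)
  | .inp x P, _, σ => .inp x (P.substD σ)
  | .rep x P, _, σ => .rep x (P.substD σ)
  | .link x y, _, _ => .link x y
  | .case x I P, _, σ => .case x I (fun l => (P l).substD σ)
  | .sel x l P, _, σ => .sel x l (P.substD σ)
  | .outAt x y ω P, _, σ => .outAt x y (ω.subst σ) (P.substD σ)
  | .inpAt x ω P, _, σ => .inpAt x (ω.subst σ) (P.substD σ)
  | .outDom x ω P, _, σ => .outDom x (ω.subst σ) (P.substD σ)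
  | .inpDom x P, _, σ => .inpDom x (P.substD (liftD σ))

/-- Passing to a scope with one more name, which does not occur free in the result. -/
def Proc.shift {W : Type u} {L : Type v} {n d : ℕ} (P : Proc W L n d) : Proc W L (n + 1) d :=
  P.rename Fin.succ

/-- Exchange of the two innermost names. -/
def Proc.swap {W : Type u} {L : Type v} {n d : ℕ} (P : Proc W L (n + 2) d) : Proc W L (n + 2) d :=
  P.rename (Equiv.swap (0 : Fin (n + 2)) 1)

/-- Structural congruence `P ≡ Q`: the least congruence (for all process constructors) satisfying
the structural laws. The shift in `extrude` expresses `x ∉ fn(P)`. -/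
inductive SCong {W : Type u} {L : Type v} :
    {n d : ℕ} → Proc W L n d → Proc W L n d → Prop
  -- equivalence
  | refl {n d : ℕ} (P : Proc W L n d) : SCong P P
  | symm {n d : ℕ} {P Q : Proc W L n d} : SCong P Q → SCong Q P
  | trans {n d : ℕ} {P Q R : Proc W L n d} : SCong P Q → SCong Q R → SCong P R
  -- structural laws
  | par_nil {n d : ℕ} (P : Proc W L n d) : SCong (.par P .nil) P
  | res_nil {n d : ℕ} : SCong (.res (.nil : Proc W L (n + 1) d)) .nil
  | link_comm {n d : ℕ} (x y : Fin n) : SCong (.link x y : Proc W L n d) (.link y x)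
  | par_comm {n d : ℕ} (P Q : Proc W L n d) : SCong (.par P Q) (.par Q P)
  | par_assoc {n d : ℕ} (P Q R : Proc W L n d) :
      SCong (.par P (.par Q R)) (.par (.par P Q) R)
  | extrude {n d : ℕ} (P : Proc W L n d) (Q : Proc W L (n + 1) d) :
      SCong (.par P (.res Q)) (.res (.par P.shift Q))
  | res_swap {n d : ℕ} (P : Proc W L (n + 2) d) : SCong (.res (.res P)) (.res (.res P.swap))
  -- congruence
  | par {n d : ℕ} {P P' Q Q' : Proc W L n d} :
      SCong P P' → SCong Q Q' → SCong (.par P Q) (.par P' Q')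
  | res {n d : ℕ} {P P' : Proc W L (n + 1) d} : SCong P P' → SCong (.res P) (.res P')
  | out {n d : ℕ} (x y : Fin n) {P P' : Proc W L n d} :
      SCong P P' → SCong (.out x y P) (.out x y P')
  | inp {n d : ℕ} (x : Fin n) {P P' : Proc W L (n + 1) d} :
      SCong P P' → SCong (.inp x P) (.inp x P')
  | rep {n d : ℕ} (x : Fin n) {P P' : Proc W L (n + 1) d} :
      SCong P P' → SCong (.rep x P) (.rep x P')
  | case {n d : ℕ} (x : Fin n) (I : Finset L) {P P' : {l : L // l ∈ I} → Proc W L n d} :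
      (∀ l, SCong (P l) (P' l)) → SCong (.case x I P) (.case x I P')
  | sel {n d : ℕ} (x : Fin n) (l : L) {P P' : Proc W L n d} :
      SCong P P' → SCong (.sel x l P) (.sel x l P')
  | outAt {n d : ℕ} (x y : Fin n) (ω : Dom W d) {P P' : Proc W L n d} :
      SCong P P' → SCong (.outAt x y ω P) (.outAt x y ω P')
  | inpAt {n d : ℕ} (x : Fin n) (ω : Dom W d) {P P' : Proc W L (n + 1) d} :
      SCong P P' → SCong (.inpAt x ω P) (.inpAt x ω P')
  | outDom {n d : ℕ} (x : Fin n) (ω : Dom W d) {P P' : Proc W L n d} :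
      SCong P P' → SCong (.outDom x ω P) (.outDom x ω P')
  | inpDom {n d : ℕ} (x : Fin n) {P P' : Proc W L n (d + 1)} :
      SCong P P' → SCong (.inpDom x P) (.inpDom x P')

/-- Reduction `P → Q`. In `fwd` the restricted name is index `0` and `y` is another name. -/
inductive Red {W : Type u} {L : Type v} :
    {n d : ℕ} → Proc W L n d → Proc W L n d → Prop
  | comm {n d : ℕ} (x y : Fin n) (Q : Proc W L n d) (P : Proc W L (n + 1) d) :
      Red (.par (.out x y Q) (.inp x P)) (.par Q (P.rename (instN y)))
  | commRep {n d : ℕ} (x y : Fin n) (Q : Proc W L n d) (P : Proc W L (n + 1) d) :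
      Red (.par (.out x y Q) (.rep x P)) (.par Q (.par (P.rename (instN y)) (.rep x P)))
  | move {n d : ℕ} (x y : Fin n) (ω ω' : Dom W d) (P : Proc W L n d) (Q : Proc W L (n + 1) d) :
      Red (.par (.outAt x y ω P) (.inpAt x ω' Q)) (.par P (Q.rename (instN y)))
  | commDom {n d : ℕ} (x : Fin n) (ω : Dom W d) (P : Proc W L n d) (Q : Proc W L n (d + 1)) :
      Red (.par (.outDom x ω P) (.inpDom x Q)) (.par P (Q.substD (instD ω)))
  | fwd {n d : ℕ} (y : Fin n) (P : Proc W L (n + 1) d) :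
      Red (.res (.par (.link 0 y.succ) P)) (P.rename (instN y))
  | choice {n d : ℕ} (x : Fin n) (I : Finset L) (l : L) (hl : l ∈ I) (P : Proc W L n d)
      (Q : {l : L // l ∈ I} → Proc W L n d) :
      Red (.par (.sel x l P) (.case x I Q)) (.par P (Q ⟨l, hl⟩))
  | par {n d : ℕ} (P : Proc W L n d) {Q Q' : Proc W L n d} :
      Red Q Q' → Red (.par P Q) (.par P Q')
  | res {n d : ℕ} {P Q : Proc W L (n + 1) d} : Red P Q → Red (.res P) (.res Q)
  | struct {n d : ℕ} {P P' Q' Q : Proc W L n d} :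
      SCong P P' → Red P' Q' → SCong Q' Q → Red P Q

/-- The non-replicated guarded processes `π.Q`. -/
inductive Guarded {W : Type u} {L : Type v} {n d : ℕ} : Proc W L n d → Prop
  | out (x y : Fin n) (P : Proc W L n d) : Guarded (.out x y P)
  | inp (x : Fin n) (P : Proc W L (n + 1) d) : Guarded (.inp x P)
  | case (x : Fin n) (I : Finset L) (P : {l : L // l ∈ I} → Proc W L n d) : Guarded (.case x I P)
  | sel (x : Fin n) (l : L) (P : Proc W L n d) : Guarded (.sel x l P)
  | outAt (x y : Fin n) (ω : Dom W d) (P : Proc W L n d) : Guarded (.outAt x y ω P)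
  | inpAt (x : Fin n) (ω : Dom W d) (P : Proc W L (n + 1) d) : Guarded (.inpAt x ω P)
  | outDom (x : Fin n) (ω : Dom W d) (P : Proc W L n d) : Guarded (.outDom x ω P)
  | inpDom (x : Fin n) (P : Proc W L n (d + 1)) : Guarded (.inpDom x P)

/-- `(νñ)P` for a sequence `ñ` of `k` names. -/
def Proc.resN {W : Type u} {L : Type v} {n d : ℕ} : (k : ℕ) → Proc W L (n + k) d → Proc W L n d
  | 0, P => P
  | k + 1, P => Proc.resN k (.res P)

/-- `live(P)`: `P ≡ (νñ)(π.Q | R)` for some names `ñ`, some `R` and some non-replicated guarded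
process `π.Q`. -/
def Live {W : Type u} {L : Type v} {n d : ℕ} (P : Proc W L n d) : Prop :=
  ∃ (k : ℕ) (G R : Proc W L (n + k) d), Guarded G ∧ SCong P (Proc.resN k (.par G R))

/-- An accessibility environment `Ω`: a collection of hypotheses `ω₁ ≺ ω₂`. -/
abbrev AccEnv (W : Type u) (d : ℕ) : Type u := Multiset (Dom W d × Dom W d)

/-- `Ω ⊢ ω₁ ≺ ω₂` -/
inductive Acc {W : Type u} {d : ℕ} : AccEnv W d → Dom W d → Dom W d → Prop
  | whyp (Ω : AccEnv W d) (ω₁ ω₂ : Dom W d) : Acc ((ω₁, ω₂) ::ₘ Ω) ω₁ ω₂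

/-- `Ω ⊢ ω₁ ≺* ω₂`, the reflexive transitive closure of `≺`. -/
def AccStar {W : Type u} {d : ℕ} (Ω : AccEnv W d) : Dom W d → Dom W d → Prop :=
  Relation.ReflTransGen (Acc Ω)

/-- Passing to a scope with one more domain variable. -/
def AccEnv.shiftD {W : Type u} {d : ℕ} (Ω : AccEnv W d) : AccEnv W (d + 1) :=
  Ω.map (fun p => (p.1.shift, p.2.shift))

/-- A type assignment `x : A[ω]`. -/
structure Asgn (W : Type u) (L : Type v) (n d : ℕ) : Type (max u v) where
  name : Fin n
  ty : Ty W L d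
  dom : Dom W d

/-- A type environment (linear or unrestricted): a collection of type assignments. -/
abbrev Ctx (W : Type u) (L : Type v) (n d : ℕ) : Type (max u v) := Multiset (Asgn W L n d)

/-- The same environment in a scope with one more name, which it does not declare. -/
def Ctx.shift {W : Type u} {L : Type v} {n d : ℕ} (Δ : Ctx W L n d) : Ctx W L (n + 1) d :=
  Δ.map (fun a => ⟨a.name.succ, a.ty, a.dom⟩)

/-- The same environment in a scope with one more domain variable, which it does not mention. -/
def Ctx.shiftD {W : Type u} {L : Type v} {n d : ℕ} (Δ : Ctx W L n d) : Ctx W L n (d + 1) :=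
  Δ.map (fun a => ⟨a.name, a.ty.shift, a.dom.shift⟩)

/-- `Ω ⊢ ω ≺* Δ`: every domain of an assignment in `Δ` is accessible from `ω`. -/
def AccCtx {W : Type u} {L : Type v} {n d : ℕ} (Ω : AccEnv W d) (ω : Dom W d)
    (Δ : Ctx W L n d) : Prop :=
  ∀ a ∈ Δ, AccStar Ω ω a.dom

/-- The typing judgment `Ω; Γ; Δ ⊢ P :: z : C[ω]`, written `Typed Ω Γ Δ P z C ω`.

A name bound in the process of a conclusion is index `0` (under two binders: `0` for the inner
and `1` for the outer one) in the premises; a bound output `(νy)x⟨y⟩.P` is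
`.res (.out x.succ 0 P)`. The shifts of environments, names and domains express the freshness side
conditions. The names declared in a sequent (in `Γ`, in `Δ`, and `z`) are meant to be pairwise
distinct, as usual; the rules preserve this from conclusion to premises, so it holds throughout
each derivation of a sequent with empty environments. -/
inductive Typed {W : Type u} {L : Type v} :
    {n d : ℕ} → AccEnv W d → Ctx W L n d → Ctx W L n d → Proc W L n d →
      Fin n → Ty W L d → Dom W d → Prop
  /-- processes are considered modulo structural congruence -/
  | struct {n d : ℕ} {Ω : AccEnv W d} {Γ Δ : Ctx W L n d} {P Q : Proc W L n d} {z : Fin n}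
      {C : Ty W L d} {ω : Dom W d} :
      SCong P Q → Typed Ω Γ Δ P z C ω → Typed Ω Γ Δ Q z C ω
  | id {n d : ℕ} {Ω : AccEnv W d} {Γ : Ctx W L n d} {x z : Fin n} {A : Ty W L d} {ω : Dom W d} :
      x ≠ z → Typed Ω Γ {⟨x, A, ω⟩} (.link x z) z A ω
  | oneR {n d : ℕ} {Ω : AccEnv W d} {Γ : Ctx W L n d} {z : Fin n} {ω : Dom W d} :
      Typed Ω Γ 0 .nil z .one ω
  | oneL {n d : ℕ} {Ω : AccEnv W d} {Γ Δ : Ctx W L n d} {P : Proc W L n d} {x z : Fin n}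
      {C : Ty W L d} {ω₁ ω₂ : Dom W d} :
      Typed Ω Γ Δ P z C ω₁ →
      Typed Ω Γ (⟨x, .one, ω₂⟩ ::ₘ Δ) P z C ω₁
  | lolliR {n d : ℕ} {Ω : AccEnv W d} {Γ Δ : Ctx W L n d} {P : Proc W L (n + 1) d} {z : Fin n}
      {A B : Ty W L d} {ω : Dom W d} :
      Typed Ω Γ.shift (⟨0, A, ω⟩ ::ₘ Δ.shift) P z.succ B ω →
      Typed Ω Γ Δ (.inp z P) z (.lolli A B) ω
  | lolliL {n d : ℕ} {Ω : AccEnv W d} {Γ Δ₁ Δ₂ : Ctx W L n d} {P Q : Proc W L (n + 1) d}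
      {x z : Fin n} {A B C : Ty W L d} {ω₁ ω₂ : Dom W d} :
      Typed Ω Γ.shift Δ₁.shift P 0 A ω₂ →
      Typed Ω Γ.shift (⟨x.succ, B, ω₂⟩ ::ₘ Δ₂.shift) Q z.succ C ω₁ →
      Typed Ω Γ (⟨x, .lolli A B, ω₂⟩ ::ₘ (Δ₁ + Δ₂)) (.res (.out x.succ 0 (.par P Q))) z C ω₁
  | tensorR {n d : ℕ} {Ω : AccEnv W d} {Γ Δ₁ Δ₂ : Ctx W L n d} {P Q : Proc W L (n + 1) d}
      {z : Fin n} {A B : Ty W L d} {ω : Dom W d} :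
      Typed Ω Γ.shift Δ₁.shift P 0 A ω →
      Typed Ω Γ.shift Δ₂.shift Q z.succ B ω →
      Typed Ω Γ (Δ₁ + Δ₂) (.res (.out z.succ 0 (.par P Q))) z (.tensor A B) ω
  | tensorL {n d : ℕ} {Ω : AccEnv W d} {Γ Δ : Ctx W L n d} {P : Proc W L (n + 1) d} {x z : Fin n}
      {A B C : Ty W L d} {ω₁ ω₂ : Dom W d} :
      Typed Ω Γ.shift (⟨0, A, ω₂⟩ ::ₘ ⟨x.succ, B, ω₂⟩ ::ₘ Δ.shift) P z.succ C ω₁ →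
      Typed Ω Γ (⟨x, .tensor A B, ω₂⟩ ::ₘ Δ) (.inp x P) z C ω₁
  | ampR {n d : ℕ} {Ω : AccEnv W d} {Γ Δ : Ctx W L n d} {I : Finset L}
      {P : {l : L // l ∈ I} → Proc W L n d} {z : Fin n} {A : {l : L // l ∈ I} → Ty W L d}
      {ω : Dom W d} :
      (∀ l, Typed Ω Γ Δ (P l) z (A l) ω) →
      Typed Ω Γ Δ (.case z I P) z (.amp I A) ω
  | ampL₁ {n d : ℕ} {Ω : AccEnv W d} {Γ Δ : Ctx W L n d} {l : L} {P : Proc W L n d} {x z : Fin n}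
      {A C : Ty W L d} {ω₁ ω₂ : Dom W d} :
      Typed Ω Γ (⟨x, A, ω₂⟩ ::ₘ Δ) P z C ω₁ →
      Typed Ω Γ (⟨x, .amp {l} (fun _ => A), ω₂⟩ ::ₘ Δ) (.sel x l P) z C ω₁
  /-- from `&{A_l}_{l ∈ I}` to `&{A_l}_{l ∈ I ∪ {k}}`, `k ∉ I` -/
  | ampL₂ {n d : ℕ} {Ω : AccEnv W d} {Γ Δ : Ctx W L n d} {I : Finset L} {k : L} {hk : k ∉ I}
      {P : Proc W L n d} {x z : Fin n} {A : {l : L // l ∈ Finset.cons k I hk} → Ty W L d}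
      {C : Ty W L d} {ω₁ ω₂ : Dom W d} :
      Typed Ω Γ
        (⟨x, .amp I (fun l => A ⟨l.1, Finset.mem_cons_of_mem l.2⟩), ω₂⟩ ::ₘ Δ) P z C ω₁ →
      Typed Ω Γ (⟨x, .amp (Finset.cons k I hk) A, ω₂⟩ ::ₘ Δ) P z C ω₁
  | plusR₁ {n d : ℕ} {Ω : AccEnv W d} {Γ Δ : Ctx W L n d} {l : L} {P : Proc W L n d} {z : Fin n}
      {A : Ty W L d} {ω : Dom W d} :
      Typed Ω Γ Δ P z A ω →
      Typed Ω Γ Δ (.sel z l P) z (.plus {l} (fun _ => A)) ω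
  /-- from `⊕{A_l}_{l ∈ I}` to `⊕{A_l}_{l ∈ I ∪ {k}}`, `k ∉ I` -/
  | plusR₂ {n d : ℕ} {Ω : AccEnv W d} {Γ Δ : Ctx W L n d} {I : Finset L} {k : L} {hk : k ∉ I}
      {P : Proc W L n d} {z : Fin n} {A : {l : L // l ∈ Finset.cons k I hk} → Ty W L d}
      {ω : Dom W d} :
      Typed Ω Γ Δ P z (.plus I (fun l => A ⟨l.1, Finset.mem_cons_of_mem l.2⟩)) ω →
      Typed Ω Γ Δ P z (.plus (Finset.cons k I hk) A) ω
  | plusL {n d : ℕ} {Ω : AccEnv W d} {Γ Δ : Ctx W L n d} {I : Finset L}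
      {Q : {l : L // l ∈ I} → Proc W L n d} {x z : Fin n} {A : {l : L // l ∈ I} → Ty W L d}
      {C : Ty W L d} {ω₁ ω₂ : Dom W d} :
      (∀ l, Typed Ω Γ (⟨x, A l, ω₂⟩ ::ₘ Δ) (Q l) z C ω₁) →
      Typed Ω Γ (⟨x, .plus I A, ω₂⟩ ::ₘ Δ) (.case x I Q) z C ω₁
  | bangR {n d : ℕ} {Ω : AccEnv W d} {Γ : Ctx W L n d} {Q : Proc W L (n + 2) d} {z : Fin n}
      {A : Ty W L d} {ω : Dom W d} :
      Typed Ω Γ.shift.shift 0 Q 0 A ω →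
      Typed Ω Γ 0 (.res (.out z.succ 0 (.rep 0 Q))) z (.bang A) ω
  | bangL {n d : ℕ} {Ω : AccEnv W d} {Γ Δ : Ctx W L n d} {P : Proc W L (n + 1) d} {x z : Fin n}
      {A C : Ty W L d} {ω₁ ω₂ : Dom W d} :
      Typed Ω (⟨0, A, ω₂⟩ ::ₘ Γ.shift) Δ.shift P z.succ C ω₁ →
      Typed Ω Γ (⟨x, .bang A, ω₂⟩ ::ₘ Δ) (.inp x P) z C ω₁
  | atR {n d : ℕ} {Ω : AccEnv W d} {Γ Δ : Ctx W L n d} {P : Proc W L (n + 1) d} {z : Fin n}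
      {A : Ty W L d} {ω₁ ω₂ : Dom W d} :
      Acc Ω ω₁ ω₂ → AccCtx Ω ω₂ Δ →
      Typed Ω Γ.shift Δ.shift P 0 A ω₂ →
      Typed Ω Γ Δ (.res (.outAt z.succ 0 ω₂ P)) z (.at_ ω₂ A) ω₁
  | atL {n d : ℕ} {Ω : AccEnv W d} {Γ Δ : Ctx W L n d} {P : Proc W L (n + 1) d} {x z : Fin n}
      {A C : Ty W L d} {ω₁ ω₂ ω₃ : Dom W d} :
      Typed ((ω₂, ω₃) ::ₘ Ω) Γ.shift (⟨0, A, ω₃⟩ ::ₘ Δ.shift) P z.succ C ω₁ →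
      Typed Ω Γ (⟨x, .at_ ω₃ A, ω₂⟩ ::ₘ Δ) (.inpAt x ω₃ P) z C ω₁
  | allR {n d : ℕ} {Ω : AccEnv W d} {Γ Δ : Ctx W L n d} {P : Proc W L n (d + 1)} {z : Fin n}
      {A : Ty W L (d + 1)} {ω₁ : Dom W d} :
      Typed ((ω₁.shift, .var 0) ::ₘ Ω.shiftD) Γ.shiftD Δ.shiftD P z A ω₁.shift →
      Typed Ω Γ Δ (.inpDom z P) z (.all A) ω₁
  | allL {n d : ℕ} {Ω : AccEnv W d} {Γ Δ : Ctx W L n d} {Q : Proc W L n d} {x z : Fin n}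
      {A : Ty W L (d + 1)} {C : Ty W L d} {ω₁ ω₂ ω₃ : Dom W d} :
      Acc Ω ω₂ ω₃ →
      Typed Ω Γ (⟨x, A.inst ω₃, ω₂⟩ ::ₘ Δ) Q z C ω₁ →
      Typed Ω Γ (⟨x, .all A, ω₂⟩ ::ₘ Δ) (.outDom x ω₃ Q) z C ω₁
  | exR {n d : ℕ} {Ω : AccEnv W d} {Γ Δ : Ctx W L n d} {P : Proc W L n d} {z : Fin n}
      {A : Ty W L (d + 1)} {ω₁ ω₂ : Dom W d} :
      Acc Ω ω₁ ω₂ →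
      Typed Ω Γ Δ P z (A.inst ω₂) ω₁ →
      Typed Ω Γ Δ (.outDom z ω₂ P) z (.ex A) ω₁
  | exL {n d : ℕ} {Ω : AccEnv W d} {Γ Δ : Ctx W L n d} {Q : Proc W L n (d + 1)} {x z : Fin n}
      {A : Ty W L (d + 1)} {C : Ty W L d} {ω₁ ω₂ : Dom W d} :
      Typed ((ω₂.shift, .var 0) ::ₘ Ω.shiftD) Γ.shiftD (⟨x, A, ω₂.shift⟩ ::ₘ Δ.shiftD) Q z
        C.shift ω₁.shift →
      Typed Ω Γ (⟨x, .ex A, ω₂⟩ ::ₘ Δ) (.inpDom x Q) z C ω₁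
  | hereR {n d : ℕ} {Ω : AccEnv W d} {Γ Δ : Ctx W L n d} {P : Proc W L n d} {z : Fin n}
      {A : Ty W L (d + 1)} {ω : Dom W d} :
      Typed Ω Γ Δ P z (A.inst ω) ω →
      Typed Ω Γ Δ P z (.here A) ω
  | hereL {n d : ℕ} {Ω : AccEnv W d} {Γ Δ : Ctx W L n d} {P : Proc W L n d} {x z : Fin n}
      {A : Ty W L (d + 1)} {C : Ty W L d} {ω₁ ω₂ : Dom W d} :
      Typed Ω Γ (⟨x, A.inst ω₂, ω₂⟩ ::ₘ Δ) P z C ω₁ →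
      Typed Ω Γ (⟨x, .here A, ω₂⟩ ::ₘ Δ) P z C ω₁
  | copy {n d : ℕ} {Ω : AccEnv W d} {Γ Δ : Ctx W L n d} {P : Proc W L (n + 1) d} {u z : Fin n}
      {A C : Ty W L d} {ω₁ ω₂ : Dom W d} :
      AccStar Ω ω₁ ω₂ → (⟨u, A, ω₂⟩ : Asgn W L n d) ∈ Γ →
      Typed Ω Γ.shift (⟨0, A, ω₂⟩ ::ₘ Δ.shift) P z.succ C ω₁ →
      Typed Ω Γ Δ (.res (.out u.succ 0 P)) z C ω₁
  | cut {n d : ℕ} {Ω : AccEnv W d} {Γ Δ₁ Δ₂ : Ctx W L n d} {P Q : Proc W L (n + 1) d} {z : Fin n}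
      {A C : Ty W L d} {ω₁ ω₂ : Dom W d} :
      AccStar Ω ω₁ ω₂ → AccCtx Ω ω₂ Δ₁ →
      Typed Ω Γ.shift Δ₁.shift P 0 A ω₂ →
      Typed Ω Γ.shift (⟨0, A, ω₂⟩ ::ₘ Δ₂.shift) Q z.succ C ω₁ →
      Typed Ω Γ (Δ₁ + Δ₂) (.res (.par P Q)) z C ω₁
  | cutBang {n d : ℕ} {Ω : AccEnv W d} {Γ Δ : Ctx W L n d} {P : Proc W L (n + 2) d}
      {Q : Proc W L (n + 1) d} {z : Fin n} {A C : Ty W L d} {ω₁ ω₂ : Dom W d} :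
      Typed Ω Γ.shift.shift 0 P 0 A ω₁ →
      Typed Ω (⟨0, A, ω₁⟩ ::ₘ Γ.shift) Δ.shift Q z.succ C ω₂ →
      Typed Ω Γ Δ (.res (.par (.rep 0 P) Q)) z C ω₂

end DomainSession

namespace DomainSession

variable {W : Type u} {L : Type v}

/-! ### Renaming -/

/-! The statement is strengthened to open sequents and proved by induction on typing. A typable
process satisfies one of three alternatives (`Progress`). It reduces; or it has an unguarded prefix
on a free channel, of a kind prescribed by the type of that channel, or an output on an unrestricted
name; or it has no unguarded non-replicated prefix, and then every linear session of the sequent,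
including the provided one, has type `𝟏` up to `↓` or is attached to a forwarder. In the closed case
at type `𝟏` no action is prescribed, and liveness excludes the third alternative, so a reduction
remains.

Prefixes and forwarders are observed through `Barb`, `HasLink` and `HasPrefix`, all invariant under
structural congruence; this absorbs the typing rule for `≡` without normal forms. Of a type only its
outermost constructor below `↓` matters (`Ty.shape`), and it is unaffected by instantiating domain
variables.

The substance is in `Progress.cut`. If both sides act on the cut channel, duality of the actions
(`Shape.Provides.matches`) gives a communication (`reduces_of_barb`). If one acts there and the
other is idle, the type is not `𝟏`, so the idle side has a forwarder on the cut channel, and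
forwarding fires. An action on another channel stays visible outside. If both are idle, so is the
composition, unless a forwarder at the cut channel fires. `Progress.cutBang` is similar, with the
replicated input always ready to answer. -/

theorem liftN_comp {n m k : ℕ} (ρ : Fin n → Fin m) (τ : Fin m → Fin k) :
    liftN τ ∘ liftN ρ = liftN (τ ∘ ρ) := by
  funext i
  refine Fin.cases ?_ (fun i => ?_) i <;> simp [liftN]

theorem liftN_injective {n m : ℕ} {ρ : Fin n → Fin m} (h : Function.Injective ρ) :
    Function.Injective (liftN ρ) := by
  intro i j
  refine Fin.cases ?_ (fun i => ?_) i <;> refine Fin.cases ?_ (fun j => ?_) j <;> simp [liftN]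
  · exact fun e => (Fin.succ_ne_zero _ e.symm).elim
  · exact fun e => h e

theorem liftN_succ {n m : ℕ} (ρ : Fin n → Fin m) (i : Fin n) : liftN ρ i.succ = (ρ i).succ := by
  simp [liftN]

theorem Proc.rename_rename {n d : ℕ} (P : Proc W L n d) {m k : ℕ} (ρ : Fin n → Fin m)
    (τ : Fin m → Fin k) : (P.rename ρ).rename τ = P.rename (τ ∘ ρ) := by
  induction P generalizing m k <;> simp_all [Proc.rename, liftN_comp]

theorem swap_succ_succ {n : ℕ} (c : Fin n) :
    Equiv.swap (0 : Fin (n + 2)) 1 c.succ.succ = c.succ.succ :=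
  Equiv.swap_apply_of_ne_of_ne (Fin.succ_ne_zero _)
    (fun h => Fin.succ_ne_zero c (Fin.succ_injective _ h))

/-! ### Unguarded prefixes and forwarders -/

/-- The kinds of prefixes. -/
inductive Act (L : Type v) : Type v
  | out | inp | rep | case (I : Finset L) | sel (l : L) | outAt | inpAt | outDom | inpDom

/-- `P` is a prefixed process with subject `c` and prefix of kind `a`. -/
inductive Prefixed {n d : ℕ} : Proc W L n d → Fin n → Act L → Prop
  | out (x y : Fin n) (P : Proc W L n d) : Prefixed (.out x y P) x .out
  | inp (x : Fin n) (P : Proc W L (n + 1) d) : Prefixed (.inp x P) x .inp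
  | rep (x : Fin n) (P : Proc W L (n + 1) d) : Prefixed (.rep x P) x .rep
  | case (x : Fin n) (I : Finset L) (P : {l : L // l ∈ I} → Proc W L n d) :
      Prefixed (.case x I P) x (.case I)
  | sel (x : Fin n) (l : L) (P : Proc W L n d) : Prefixed (.sel x l P) x (.sel l)
  | outAt (x y : Fin n) (ω : Dom W d) (P : Proc W L n d) : Prefixed (.outAt x y ω P) x .outAt
  | inpAt (x : Fin n) (ω : Dom W d) (P : Proc W L (n + 1) d) : Prefixed (.inpAt x ω P) x .inpAt
  | outDom (x : Fin n) (ω : Dom W d) (P : Proc W L n d) : Prefixed (.outDom x ω P) x .outDom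
  | inpDom (x : Fin n) (P : Proc W L n (d + 1)) : Prefixed (.inpDom x P) x .inpDom

/-- `P` has an unguarded prefix of kind `a` whose subject is the free name `c`. -/
def Barb {n d : ℕ} : Proc W L n d → Fin n → Act L → Prop
  | .par P Q, c, a => Barb P c a ∨ Barb Q c a
  | .res P, c, a => Barb P c.succ a
  | P, c, a => Prefixed P c a

/-- `P` has an unguarded forwarder between the free names `x` and `y`. -/
def HasLink {n d : ℕ} : Proc W L n d → Fin n → Fin n → Prop
  | .par P Q, x, y => HasLink P x y ∨ HasLink Q x y
  | .res P, x, y => HasLink P x.succ y.succ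
  | .link u v, x, y => (u = x ∧ v = y) ∨ (u = y ∧ v = x)
  | _, _, _ => False

/-- `P` has an unguarded non-replicated prefix. -/
def HasPrefix {n d : ℕ} : Proc W L n d → Prop
  | .nil => False
  | .par P Q => HasPrefix P ∨ HasPrefix Q
  | .res P => HasPrefix P
  | .rep _ _ => False
  | .link _ _ => False
  | _ => True

theorem Prefixed.rename {n m d : ℕ} {P : Proc W L n d} {c : Fin n} {a : Act L}
    (h : Prefixed P c a) (ρ : Fin n → Fin m) : Prefixed (P.rename ρ) (ρ c) a := by
  cases h <;> constructor

/-- Injectivity keeps distinct subjects apart: otherwise the renamed process could act on the image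
of `c` through a prefix on another name. -/
theorem barb_rename {n d : ℕ} (P : Proc W L n d) {m : ℕ} {ρ : Fin n → Fin m}
    (hρ : Function.Injective ρ) (c : Fin n) (a : Act L) :
    Barb (P.rename ρ) (ρ c) a ↔ Barb P c a := by
  induction P generalizing m with
  | par P Q ihP ihQ => simp [Proc.rename, Barb, ihP hρ, ihQ hρ]
  | res P ih =>
    simp only [Proc.rename, Barb]
    rw [← liftN_succ, ih (liftN_injective hρ)]
  | _ =>
    simp only [Proc.rename, Barb]
    constructor
    · intro h
      -- Case analysis needs a variable as subject; injectivity then recovers `c` from its image.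
      generalize hc : ρ c = c' at h
      cases h <;> (cases hρ hc; constructor)
    · intro h
      cases h <;> constructor

theorem hasLink_rename {n d : ℕ} (P : Proc W L n d) {m : ℕ} {ρ : Fin n → Fin m}
    (hρ : Function.Injective ρ) (x y : Fin n) :
    HasLink (P.rename ρ) (ρ x) (ρ y) ↔ HasLink P x y := by
  induction P generalizing m with
  | par P Q ihP ihQ => simp [Proc.rename, HasLink, ihP hρ, ihQ hρ]
  | res P ih =>
    simp only [Proc.rename, HasLink]
    rw [← liftN_succ, ← liftN_succ, ih (liftN_injective hρ)]
  | link u v => simp [Proc.rename, HasLink, hρ.eq_iff]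
  | _ => simp [Proc.rename, HasLink]

theorem hasPrefix_rename {n d : ℕ} (P : Proc W L n d) {m : ℕ} (ρ : Fin n → Fin m) :
    HasPrefix (P.rename ρ) ↔ HasPrefix P := by
  induction P generalizing m <;> simp_all [Proc.rename, HasPrefix]

theorem barb_shift {n d : ℕ} (P : Proc W L n d) (c : Fin n) (a : Act L) :
    Barb P.shift c.succ a ↔ Barb P c a :=
  barb_rename P (Fin.succ_injective n) c a

/-- Structural laws only rearrange unguarded components. Congruence under a prefix changes the
continuation but neither the subject nor the kind of the prefix. -/
theorem SCong.barb_iff {n d : ℕ} {P Q : Proc W L n d} (h : SCong P Q) (c : Fin n) (a : Act L) :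
    Barb P c a ↔ Barb Q c a := by
  induction h with
  | refl => rfl
  | symm _ ih => exact (ih c).symm
  | trans _ _ ih₁ ih₂ => exact (ih₁ c).trans (ih₂ c)
  | par_nil P =>
    exact ⟨fun h => h.elim id (fun h => by cases h), Or.inl⟩
  | res_nil => constructor <;> (intro h; cases h)
  | link_comm x y => constructor <;> (intro h; cases h)
  | par_comm P Q => exact or_comm
  | par_assoc P Q R => exact or_assoc.symm
  | extrude P Q => simp only [Barb, barb_shift]
  | res_swap P =>
    simp only [Barb]
    -- Seen under two binders, the free name `c` has index at least `2`, so exchanging the two bound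
    -- names fixes it.
    rw [← barb_rename P (Equiv.swap (0 : Fin _) 1).injective, swap_succ_succ]
    rfl
  | par _ _ ih₁ ih₂ => exact or_congr (ih₁ c) (ih₂ c)
  | res _ ih => exact ih c.succ
  | _ => constructor <;> (intro h; cases h; constructor)

theorem SCong.hasLink_iff {n d : ℕ} {P Q : Proc W L n d} (h : SCong P Q) (x y : Fin n) :
    HasLink P x y ↔ HasLink Q x y := by
  induction h with
  | refl => rfl
  | symm _ ih => exact (ih x y).symm
  | trans _ _ ih₁ ih₂ => exact (ih₁ x y).trans (ih₂ x y)
  | par_nil P => simp [HasLink]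
  | link_comm u v => simp only [HasLink]; tauto
  | par_comm P Q => exact or_comm
  | par_assoc P Q R => exact or_assoc.symm
  | extrude P Q =>
    simp only [HasLink, Proc.shift]
    rw [hasLink_rename P (Fin.succ_injective _)]
  | res_swap P =>
    simp only [HasLink]
    rw [← hasLink_rename P (Equiv.swap (0 : Fin _) 1).injective, swap_succ_succ, swap_succ_succ]
    rfl
  | par _ _ ih₁ ih₂ => exact or_congr (ih₁ x y) (ih₂ x y)
  | res _ ih => exact ih x.succ y.succ
  | _ => simp [HasLink]

theorem SCong.hasPrefix_iff {n d : ℕ} {P Q : Proc W L n d} (h : SCong P Q) :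
    HasPrefix P ↔ HasPrefix Q := by
  induction h with
  | symm _ ih => exact ih.symm
  | trans _ _ ih₁ ih₂ => exact ih₁.trans ih₂
  | par_comm P Q => exact or_comm
  | par_assoc P Q R => exact or_assoc.symm
  | extrude P Q => simp [HasPrefix, Proc.shift, hasPrefix_rename]
  | res_swap P => simp [HasPrefix, Proc.swap, hasPrefix_rename]
  | par _ _ ih₁ ih₂ => exact or_congr ih₁ ih₂
  | res _ ih => exact ih
  | _ => simp [HasPrefix]

theorem hasPrefix_resN {n d : ℕ} (k : ℕ) (P : Proc W L (n + k) d) :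
    HasPrefix (Proc.resN k P) ↔ HasPrefix P := by
  induction k with
  | zero => rfl
  | succ k ih => exact ih (.res P)

/-- Liveness speaks of some process congruent to `P`; invariance of `HasPrefix` turns it into a
syntactic property of `P` itself. -/
theorem Live.hasPrefix {n d : ℕ} {P : Proc W L n d} (h : Live P) : HasPrefix P := by
  obtain ⟨k, G, R, hG, hP⟩ := h
  rw [hP.hasPrefix_iff, hasPrefix_resN]
  exact Or.inl (by cases hG <;> trivial)

/-! ### Sources of reduction -/

/-- `P` has a reduction. -/
def Reduces {n d : ℕ} (P : Proc W L n d) : Prop := ∃ Q, Red P Q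

theorem Reduces.congr {n d : ℕ} {P Q : Proc W L n d} (h : SCong P Q) : Reduces Q → Reduces P :=
  fun ⟨R, hR⟩ => ⟨R, .struct h hR (.refl _)⟩

theorem Reduces.par_right {n d : ℕ} (P : Proc W L n d) {Q : Proc W L n d} :
    Reduces Q → Reduces (.par P Q) :=
  fun ⟨_, hR⟩ => ⟨_, .par P hR⟩

theorem Reduces.par_left {n d : ℕ} {P : Proc W L n d} (Q : Proc W L n d) (h : Reduces P) :
    Reduces (.par P Q) :=
  (h.par_right Q).congr (.par_comm _ _)

theorem Reduces.res {n d : ℕ} {P : Proc W L (n + 1) d} : Reduces P → Reduces (.res P) :=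
  fun ⟨_, hR⟩ => ⟨_, .res hR⟩

theorem SCong.par_par_left {n d : ℕ} (P₁ P₂ Q : Proc W L n d) :
    SCong (.par (.par P₁ P₂) Q) (.par P₂ (.par P₁ Q)) :=
  ((SCong.par (.par_comm _ _) (.refl _))).trans (.symm (.par_assoc _ _ _))

theorem SCong.res_par {n d : ℕ} (P : Proc W L (n + 1) d) (Q : Proc W L n d) :
    SCong (.par (.res P) Q) (.res (.par P Q.shift)) :=
  (SCong.par_comm _ _).trans ((SCong.extrude _ _).trans (.res (.par_comm _ _)))

/-- A prefix of the first kind sends what a prefix of the second kind receives. -/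
inductive Act.Matches : Act L → Act L → Prop
  | comm : Matches .out .inp
  | commRep : Matches .out .rep
  | choice (l : L) (I : Finset L) : l ∈ I → Matches (.sel l) (.case I)
  | move : Matches .outAt .inpAt
  | commDom : Matches .outDom .inpDom

theorem reduces_of_prefixed {n d : ℕ} {P Q : Proc W L n d} {c : Fin n} {a b : Act L}
    (hP : Prefixed P c a) (hQ : Prefixed Q c b) (h : a.Matches b) : Reduces (.par P Q) := by
  cases h with
  | comm => cases hP; cases hQ; exact ⟨_, .comm _ _ _ _⟩
  | commRep => cases hP; cases hQ; exact ⟨_, .commRep _ _ _ _⟩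
  | choice l I hl => cases hP; cases hQ; exact ⟨_, .choice _ _ _ hl _ _⟩
  | move => cases hP; cases hQ; exact ⟨_, .move _ _ _ _ _ _⟩
  | commDom => cases hP; cases hQ; exact ⟨_, .commDom _ _ _ _⟩

/-- Parallel components are reassociated and restrictions of `Q` are extruded over `P` until the
second prefix stands next to the first. -/
theorem reduces_of_prefixed_of_barb {n d : ℕ} {P Q : Proc W L n d} {c : Fin n} {a b : Act L}
    (hP : Prefixed P c a) (hQ : Barb Q c b) (h : a.Matches b) : Reduces (.par P Q) := by
  induction Q with
  | par Q₁ Q₂ ih₁ ih₂ =>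
    rcases hQ with hQ | hQ
    · exact ((ih₁ hP hQ).par_left Q₂).congr (.par_assoc _ _ _)
    · exact ((ih₂ hP hQ).par_right Q₁).congr
        ((SCong.par (.refl _) (.par_comm _ _)).trans ((SCong.par_assoc _ _ _).trans (.par_comm _ _)))
  | res Q ih => exact (ih (hP.rename Fin.succ) hQ).res.congr (.extrude _ _)
  | _ => exact reduces_of_prefixed hP hQ h

theorem reduces_of_barb {n d : ℕ} {P Q : Proc W L n d} {c : Fin n} {a b : Act L}
    (hP : Barb P c a) (hQ : Barb Q c b) (h : a.Matches b) : Reduces (.par P Q) := by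
  induction P with
  | par P₁ P₂ ih₁ ih₂ =>
    rcases hP with hP | hP
    · exact ((ih₁ hP hQ).par_right P₂).congr (.par_par_left _ _ _)
    · exact ((ih₂ hP hQ).par_right P₁).congr (.symm (.par_assoc _ _ _))
  | res P ih => exact (ih hP ((barb_shift Q c b).2 hQ)).res.congr (.res_par _ _)
  | _ => exact reduces_of_prefixed_of_barb hP hQ h

/-- The forwarding rule wants the forwarder directly under the restriction of one of its ends, at
index `0`. Descending into `P` moves parallel components into `Q` and carries inner restrictions
outwards; the renaming `ρ` records the resulting change of indices, so that the induction stays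
structural in `P`. -/
theorem reduces_of_hasLink_rename {n d : ℕ} {P : Proc W L n d} {x y : Fin n} (h : HasLink P x y)
    {m : ℕ} (ρ : Fin n → Fin (m + 1)) (w : Fin m) (hx : ρ x = 0) (hy : ρ y = w.succ)
    (Q : Proc W L (m + 1) d) : Reduces (.res (.par (P.rename ρ) Q)) := by
  induction P generalizing m with
  | par P₁ P₂ ih₁ ih₂ =>
    rcases h with h | h
    · exact (ih₁ h ρ w hx hy (.par (P₂.rename ρ) Q)).congr (.res (.symm (.par_assoc _ _ _)))
    · exact (ih₂ h ρ w hx hy (.par (P₁.rename ρ) Q)).congr (.res (.par_par_left _ _ _))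
  | res P ih =>
    -- Below the inner restriction the forwarded name has index `1`; the swap brings it back to `0`
    -- and leaves the other end fixed. The inner restriction thereby becomes the outer one.
    have key := (ih h (Equiv.swap (0 : Fin (m + 2)) 1 ∘ liftN ρ) w.succ
      (by simp [liftN_succ, hx]) (by simp [liftN_succ, hy, swap_succ_succ]) Q.shift.swap).res
    rw [← Proc.rename_rename] at key
    exact key.congr ((SCong.res (.res_par _ _)).trans (.res_swap _))
  | link u v =>
    rcases h with ⟨rfl, rfl⟩ | ⟨rfl, rfl⟩
    · simp only [Proc.rename, hx, hy]
      exact ⟨_, .fwd _ _⟩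
    · simp only [Proc.rename, hx, hy]
      exact Reduces.congr (.res (.par (.link_comm _ _) (.refl _))) ⟨_, .fwd _ _⟩
  | _ => exact h.elim

theorem Proc.rename_id {n d : ℕ} (P : Proc W L n d) : P.rename id = P := by
  have h : ∀ n : ℕ, liftN (id : Fin n → Fin n) = id := by
    intro n; funext i; refine Fin.cases ?_ (fun i => ?_) i <;> simp [liftN]
  induction P <;> simp_all [Proc.rename]

theorem reduces_of_hasLink_left {n d : ℕ} {P : Proc W L (n + 1) d} (Q : Proc W L (n + 1) d)
    {w : Fin (n + 1)} (hw : w ≠ 0) (h : HasLink P 0 w) : Reduces (.res (.par P Q)) := by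
  obtain ⟨w, rfl⟩ := Fin.exists_succ_eq.2 hw
  simpa only [Proc.rename_id] using reduces_of_hasLink_rename h id w rfl rfl Q

theorem reduces_of_hasLink_right {n d : ℕ} (P : Proc W L (n + 1) d) {Q : Proc W L (n + 1) d}
    {w : Fin (n + 1)} (hw : w ≠ 0) (h : HasLink Q 0 w) : Reduces (.res (.par P Q)) :=
  (reduces_of_hasLink_left P hw h).congr (.res (.par_comm _ _))

theorem HasLink.symm {n d : ℕ} {P : Proc W L n d} {x y : Fin n} (h : HasLink P x y) :
    HasLink P y x := by
  induction P with
  | par P Q ihP ihQ => exact h.imp ihP ihQ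
  | res P ih => exact ih h
  | link u v => exact Or.symm h
  | _ => exact h.elim

/-! ### Actions prescribed by types -/

/-- The outermost constructor of a type below the `↓` quantifiers. -/
inductive Shape (L : Type v) : Type v
  | one | lolli | tensor | amp (I : Finset L) | plus (I : Finset L) | bang | at_ | all | ex

/-- The shape of a type. -/
def Ty.shape {d : ℕ} : Ty W L d → Shape L
  | .one => .one
  | .lolli _ _ => .lolli
  | .tensor _ _ => .tensor
  | .amp I _ => .amp I
  | .plus I _ => .plus I
  | .bang _ => .bang
  | .at_ _ _ => .at_
  | .all _ => .all
  | .ex _ => .ex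
  | .here A => A.shape

/-- Substitution replaces domains only and never a type constructor. This makes the `↓` rules
invisible to shapes. -/
theorem Ty.shape_subst {d e : ℕ} (A : Ty W L d) (σ : Fin d → Dom W e) :
    (A.subst σ).shape = A.shape := by
  induction A generalizing e <;> simp_all [Ty.subst, Ty.shape]

/-- The actions of a provider of a session on its channel. -/
inductive Shape.Provides : Shape L → Act L → Prop
  | lolli : Provides .lolli .inp
  | tensor : Provides .tensor .out
  | amp (I : Finset L) : Provides (.amp I) (.case I)
  | plus (I : Finset L) (l : L) : l ∈ I → Provides (.plus I) (.sel l)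
  | bang : Provides .bang .out
  | at_ : Provides .at_ .outAt
  | all : Provides .all .inpDom
  | ex : Provides .ex .outDom

/-- The actions of a client of a session on its channel. -/
inductive Shape.Uses : Shape L → Act L → Prop
  | lolli : Uses .lolli .out
  | tensor : Uses .tensor .inp
  | amp (I : Finset L) (l : L) : l ∈ I → Uses (.amp I) (.sel l)
  | plus (I : Finset L) : Uses (.plus I) (.case I)
  | bang : Uses .bang .inp
  | at_ : Uses .at_ .inpAt
  | all : Uses .all .outDom
  | ex : Uses .ex .inpDom

/-- For each shape one partner sends and the other receives; which one depends on the shape, whence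
the disjunction. For the two choices, membership of the selected label in `I` is what makes the
selection answerable. -/
theorem Shape.Provides.matches {s : Shape L} {a b : Act L} (ha : s.Provides a) (hb : s.Uses b) :
    a.Matches b ∨ b.Matches a := by
  cases ha <;> cases hb <;> first
    | exact Or.inl (by constructor <;> assumption)
    | exact Or.inr (by constructor <;> assumption)

/-- The action of kind `a` on `c` is one that the sequent `Γ; Δ ⊢ z : C` allows. -/
inductive Allowed {n d : ℕ} (Γ Δ : Ctx W L n d) (z : Fin n) (C : Ty W L d) :
    Fin n → Act L → Prop
  | right {a : Act L} : C.shape.Provides a → Allowed Γ Δ z C z a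
  | left {a : Act L} (x : Asgn W L n d) : x ∈ Δ → x.ty.shape.Uses a → Allowed Γ Δ z C x.name a
  | copy (x : Asgn W L n d) : x ∈ Γ → Allowed Γ Δ z C x.name .out

/-- A session of shape `s` on the channel `c` of `P` needs no action of `P`. -/
def Idle {n d : ℕ} (P : Proc W L n d) (c : Fin n) (s : Shape L) : Prop :=
  s = .one ∨ ∃ w, w ≠ c ∧ HasLink P c w

/-! ### The progress invariant and its monotonicity -/

/-- A process reduces, or acts on one of its free channels as its typing prescribes, or has no
action at all, and then each of its linear sessions is terminated or forwarded. -/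
inductive Progress {n d : ℕ} (Γ Δ : Ctx W L n d) (P : Proc W L n d) (z : Fin n) (C : Ty W L d) :
    Prop
  | red : Reduces P → Progress Γ Δ P z C
  | act (c : Fin n) (a : Act L) : Barb P c a → Allowed Γ Δ z C c a → Progress Γ Δ P z C
  | idle : ¬ HasPrefix P → (∀ x ∈ Δ, Idle P x.name x.ty.shape) → Idle P z C.shape →
      Progress Γ Δ P z C

theorem Progress.congr {n d : ℕ} {Γ Δ : Ctx W L n d} {P Q : Proc W L n d} {z : Fin n}
    {C : Ty W L d} (h : SCong P Q) : Progress Γ Δ P z C → Progress Γ Δ Q z C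
  | .red hP => .red (hP.congr h.symm)
  | .act c a hb ha => .act c a ((h.barb_iff c a).1 hb) ha
  | .idle h₁ h₂ h₃ => by
    have hI : ∀ c s, Idle P c s → Idle Q c s := fun c s =>
      Or.imp_right fun ⟨w, hw, hl⟩ => ⟨w, hw, (h.hasLink_iff c w).1 hl⟩
    exact .idle (h.hasPrefix_iff.not.1 h₁) (fun x hx => hI _ _ (h₂ x hx)) (hI _ _ h₃)

/-- Serves the right rules that change the type but not the process: `plusR₂` and `hereR`. -/
theorem Progress.mono_type {n d : ℕ} {Γ Δ : Ctx W L n d} {P : Proc W L n d} {z : Fin n}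
    {C C' : Ty W L d} (hp : ∀ a, C.shape.Provides a → C'.shape.Provides a)
    (h1 : C.shape = .one → C'.shape = .one) (h : Progress Γ Δ P z C) : Progress Γ Δ P z C' := by
  rcases h with hP | ⟨_, _, hb, ha⟩ | ⟨h₁, h₂, h₃⟩
  · exact .red hP
  · rcases ha with ha | ⟨x, hx, ha⟩ | ⟨x, hx⟩
    · exact .act _ _ hb (.right (hp _ ha))
    · exact .act _ _ hb (.left x hx ha)
    · exact .act _ _ hb (.copy x hx)
  · exact .idle h₁ h₂ (h₃.imp_left h1)

/-- Serves the left rules that keep the process: `oneL`, `ampL₂` and `hereL`. The first alternative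
of `h1` admits a new terminated session, which is idle outright. -/
theorem Progress.mono_ctx {n d : ℕ} {Γ Δ Δ' : Ctx W L n d} {P : Proc W L n d} {z : Fin n}
    {C : Ty W L d}
    (hp : ∀ x ∈ Δ, ∀ a, x.ty.shape.Uses a → ∃ y ∈ Δ', y.name = x.name ∧ y.ty.shape.Uses a)
    (h1 : ∀ y ∈ Δ', y.ty.shape = .one ∨
      ∃ x ∈ Δ, x.name = y.name ∧ (x.ty.shape = .one → y.ty.shape = .one))
    (h : Progress Γ Δ P z C) : Progress Γ Δ' P z C := by
  rcases h with hP | ⟨_, _, hb, ha⟩ | ⟨h₁, h₂, h₃⟩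
  · exact .red hP
  · rcases ha with ha | ⟨x, hx, ha⟩ | ⟨x, hx⟩
    · exact .act _ _ hb (.right ha)
    · obtain ⟨y, hy, hyx, ha⟩ := hp x hx _ ha
      rw [← hyx] at hb
      exact .act _ _ hb (.left y hy ha)
    · exact .act _ _ hb (.copy x hx)
  · refine .idle h₁ (fun y hy => ?_) h₃
    rcases h1 y hy with h | ⟨x, hx, hxy, h⟩
    · exact .inl h
    · exact hxy ▸ (h₂ x hx).imp_left h

theorem Progress.cons_one {n d : ℕ} {Γ Δ : Ctx W L n d} {P : Proc W L n d} {z x : Fin n}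
    {C : Ty W L d} {ω : Dom W d} (h : Progress Γ Δ P z C) :
    Progress Γ (⟨x, .one, ω⟩ ::ₘ Δ) P z C := by
  refine h.mono_ctx (fun y hy a ha => ⟨y, Multiset.mem_cons_of_mem hy, rfl, ha⟩) (fun y hy => ?_)
  rcases Multiset.mem_cons.1 hy with rfl | hy
  · exact .inl rfl
  · exact .inr ⟨y, hy, rfl, id⟩

theorem Progress.mono_head {n d : ℕ} {Γ Δ : Ctx W L n d} {P : Proc W L n d} {z x : Fin n}
    {A A' C : Ty W L d} {ω ω' : Dom W d} (hp : ∀ a, A.shape.Uses a → A'.shape.Uses a)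
    (h1 : A.shape = .one → A'.shape = .one) (h : Progress Γ (⟨x, A, ω⟩ ::ₘ Δ) P z C) :
    Progress Γ (⟨x, A', ω'⟩ ::ₘ Δ) P z C := by
  refine h.mono_ctx (fun y hy a ha => ?_) (fun y hy => ?_) <;>
    rcases Multiset.mem_cons.1 hy with rfl | hy
  · exact ⟨_, Multiset.mem_cons_self _ _, rfl, hp a ha⟩
  · exact ⟨y, Multiset.mem_cons_of_mem hy, rfl, ha⟩
  · exact .inr ⟨_, Multiset.mem_cons_self _ _, rfl, h1⟩
  · exact .inr ⟨y, Multiset.mem_cons_of_mem hy, rfl, id⟩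

theorem Progress.provide {n d : ℕ} {Γ Δ : Ctx W L n d} {P : Proc W L n d} {z : Fin n}
    {C : Ty W L d} (a : Act L) (hb : Barb P z a) (ha : C.shape.Provides a) : Progress Γ Δ P z C :=
  .act z a hb (.right ha)

theorem Progress.use {n d : ℕ} {Γ Δ : Ctx W L n d} {P : Proc W L n d} {z x : Fin n}
    {A C : Ty W L d} {ω : Dom W d} (a : Act L) (hb : Barb P x a) (ha : A.shape.Uses a) :
    Progress Γ (⟨x, A, ω⟩ ::ₘ Δ) P z C :=
  .act x a hb (.left ⟨x, A, ω⟩ (Multiset.mem_cons_self _ _) ha)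

theorem Ctx.mem_shift {n d : ℕ} {Δ : Ctx W L n d} {x : Asgn W L (n + 1) d} :
    x ∈ Δ.shift ↔ ∃ y ∈ Δ, x = ⟨y.name.succ, y.ty, y.dom⟩ := by
  simp [Ctx.shift, eq_comm]

/-! ### Idle sessions and progress through cuts -/

/-- An idle session on an outer channel stays idle under a restriction, unless the restricted
name is forwarded. -/
theorem Idle.res {n d : ℕ} {P : Proc W L (n + 1) d} {c : Fin n} {s : Shape L}
    (h : Idle P c.succ s) : (∃ w, w ≠ 0 ∧ HasLink P 0 w) ∨ Idle (.res P) c s := by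
  rcases h with h | ⟨w, hw, hl⟩
  · exact Or.inr (Or.inl h)
  · induction w using Fin.cases with
    -- The far end is the restricted name itself; read backwards, the forwarder leads from it to an
    -- outer name.
    | zero => exact Or.inl ⟨_, Fin.succ_ne_zero c, hl.symm⟩
    | succ w => exact Or.inr (Or.inr ⟨w, fun e => hw (e ▸ rfl), hl⟩)

theorem Idle.par_left {n d : ℕ} {P : Proc W L n d} (Q : Proc W L n d) {c : Fin n} {s : Shape L} :
    Idle P c s → Idle (.par P Q) c s :=
  Or.imp_right fun ⟨w, hw, hl⟩ => ⟨w, hw, Or.inl hl⟩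

theorem Idle.par_right {n d : ℕ} (P : Proc W L n d) {Q : Proc W L n d} {c : Fin n} {s : Shape L} :
    Idle Q c s → Idle (.par P Q) c s :=
  Or.imp_right fun ⟨w, hw, hl⟩ => ⟨w, hw, Or.inr hl⟩

theorem reduces_of_hasLink {n d : ℕ} {P Q : Proc W L (n + 1) d} :
    (∃ w, w ≠ 0 ∧ HasLink (.par P Q) 0 w) → Reduces (.res (.par P Q))
  | ⟨_, hw, .inl hl⟩ => reduces_of_hasLink_left Q hw hl
  | ⟨_, hw, .inr hl⟩ => reduces_of_hasLink_right P hw hl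

/-- A composition without actions under a restriction is idle on all outer channels or reduces. -/
theorem Progress.res_par_of_idle {n d : ℕ} {Γ Δ : Ctx W L n d} {P Q : Proc W L (n + 1) d}
    {z : Fin n} {C : Ty W L d} (h₁ : ¬ HasPrefix (.par P Q))
    (h₂ : ∀ x ∈ Δ, Idle (.par P Q) x.name.succ x.ty.shape)
    (h₃ : Idle (.par P Q) z.succ C.shape) : Progress Γ Δ (.res (.par P Q)) z C := by
  by_cases hl : ∃ w, w ≠ 0 ∧ HasLink (.par P Q) 0 w
  · exact .red (reduces_of_hasLink hl)
  · exact .idle h₁ (fun x hx => (h₂ x hx).res.resolve_left hl) (h₃.res.resolve_left hl)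

/-- Each side acts on the cut channel, or settles the claim alone by reducing or acting on an outer
channel, or is idle. The remaining combinations are resolved by duality and by forwarding. -/
theorem Progress.cut {n d : ℕ} {Γ Δ₁ Δ₂ : Ctx W L n d} {P Q : Proc W L (n + 1) d} {z : Fin n}
    {A C : Ty W L d} {ω : Dom W d} (hP : Progress Γ.shift Δ₁.shift P 0 A)
    (hQ : Progress Γ.shift (⟨0, A, ω⟩ ::ₘ Δ₂.shift) Q z.succ C) :
    Progress Γ (Δ₁ + Δ₂) (.res (.par P Q)) z C := by
  have hPc : (∃ a, Barb P 0 a ∧ A.shape.Provides a) ∨ Progress Γ (Δ₁ + Δ₂) (.res (.par P Q)) z C ∨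
      (¬ HasPrefix P ∧ (∀ x ∈ Δ₁.shift, Idle P x.name x.ty.shape) ∧ Idle P 0 A.shape) := by
    rcases hP with hP | ⟨_, _, hb, ha⟩ | ⟨h₁, h₂, h₃⟩
    · exact .inr (.inl (.red (hP.par_left Q).res))
    · rcases ha with ha | ⟨x, hx, ha⟩ | ⟨x, hx⟩
      · exact .inl ⟨_, hb, ha⟩
      · obtain ⟨y, hy, rfl⟩ := Ctx.mem_shift.1 hx
        exact .inr (.inl (.act _ _ (Or.inl hb)
          (.left y (Multiset.mem_add.2 (.inl hy)) ha)))
      · obtain ⟨y, hy, rfl⟩ := Ctx.mem_shift.1 hx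
        exact .inr (.inl (.act _ _ (Or.inl hb) (.copy y hy)))
    · exact .inr (.inr ⟨h₁, h₂, h₃⟩)
  have hQc : (∃ a, Barb Q 0 a ∧ A.shape.Uses a) ∨ Progress Γ (Δ₁ + Δ₂) (.res (.par P Q)) z C ∨
      (¬ HasPrefix Q ∧ (∀ x ∈ (⟨0, A, ω⟩ ::ₘ Δ₂.shift : Ctx W L (n + 1) d),
        Idle Q x.name x.ty.shape) ∧ Idle Q z.succ C.shape) := by
    rcases hQ with hQ | ⟨_, _, hb, ha⟩ | ⟨h₁, h₂, h₃⟩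
    · exact .inr (.inl (.red (hQ.par_right P).res))
    · rcases ha with ha | ⟨x, hx, ha⟩ | ⟨x, hx⟩
      · exact .inr (.inl (.act _ _ (Or.inr hb) (.right ha)))
      · rcases Multiset.mem_cons.1 hx with rfl | hx
        · exact .inl ⟨_, hb, ha⟩
        · obtain ⟨y, hy, rfl⟩ := Ctx.mem_shift.1 hx
          exact .inr (.inl (.act _ _ (Or.inr hb)
            (.left y (Multiset.mem_add.2 (.inr hy)) ha)))
      · obtain ⟨y, hy, rfl⟩ := Ctx.mem_shift.1 hx
        exact .inr (.inl (.act _ _ (Or.inr hb) (.copy y hy)))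
    · exact .inr (.inr ⟨h₁, h₂, h₃⟩)
  rcases hPc with ⟨a, hPa, ha⟩ | h | ⟨hP₁, hP₂, hP₃⟩
  · rcases hQc with ⟨b, hQb, hb⟩ | h | ⟨hQ₁, hQ₂, hQ₃⟩
    · rcases ha.matches hb with h | h
      · exact .red (reduces_of_barb hPa hQb h).res
      · exact .red ((reduces_of_barb hQb hPa h).congr (.par_comm _ _)).res
    · exact h
    · rcases hQ₂ _ (Multiset.mem_cons_self _ _) with h | ⟨w, hw, hl⟩
      -- The provider acts on the cut channel, which no provider of `𝟏` does; so the idle client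
      -- must have a forwarder there.
      · change A.shape = .one at h
        rw [h] at ha
        cases ha
      · exact .red (reduces_of_hasLink_right P hw hl)
  · exact h
  · rcases hQc with ⟨b, hQb, hb⟩ | h | ⟨hQ₁, hQ₂, hQ₃⟩
    · rcases hP₃ with h | ⟨w, hw, hl⟩
      · rw [h] at hb
        cases hb
      · exact .red (reduces_of_hasLink_left Q hw hl)
    · exact h
    · refine .res_par_of_idle (not_or.2 ⟨hP₁, hQ₁⟩) (fun x hx => ?_) (hQ₃.par_right P)
      rcases Multiset.mem_add.1 hx with hx | hx
      · exact (hP₂ _ (Ctx.mem_shift.2 ⟨x, hx, rfl⟩)).par_left Q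
      · exact (hQ₂ _ (Multiset.mem_cons_of_mem (Ctx.mem_shift.2 ⟨x, hx, rfl⟩))).par_right P

/-- The server is guarded by replication, so it never reduces alone and does not count for
`HasPrefix`; only the progress of `Q` matters. An output of `Q` on the cut name is answered by the
replicated input. -/
theorem Progress.cutBang {n d : ℕ} {Γ Δ : Ctx W L n d} {P : Proc W L (n + 2) d}
    {Q : Proc W L (n + 1) d} {z : Fin n} {A C : Ty W L d} {ω : Dom W d}
    (hQ : Progress (⟨0, A, ω⟩ ::ₘ Γ.shift) Δ.shift Q z.succ C) :
    Progress Γ Δ (.res (.par (.rep 0 P) Q)) z C := by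
  rcases hQ with hQ | ⟨_, _, hb, ha⟩ | ⟨h₁, h₂, h₃⟩
  · exact .red (hQ.par_right _).res
  · rcases ha with ha | ⟨x, hx, ha⟩ | ⟨x, hx⟩
    · exact .act _ _ (Or.inr hb) (.right ha)
    · obtain ⟨y, hy, rfl⟩ := Ctx.mem_shift.1 hx
      exact .act _ _ (Or.inr hb) (.left y hy ha)
    · rcases Multiset.mem_cons.1 hx with rfl | hx
      · have hrep : Barb (.rep 0 P) 0 .rep := Prefixed.rep 0 P
        exact .red ((reduces_of_barb hb hrep .commRep).congr (.par_comm _ _)).res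
      · obtain ⟨y, hy, rfl⟩ := Ctx.mem_shift.1 hx
        exact .act _ _ (Or.inr hb) (.copy y hy)
  · exact .res_par_of_idle (not_or.2 ⟨id, h₁⟩)
      (fun x hx => (h₂ _ (Ctx.mem_shift.2 ⟨x, hx, rfl⟩)).par_right _) (h₃.par_right _)

/-- Rules that introduce a prefix, and `copy`, exhibit an allowed action at once. The induction
hypothesis is needed only for the cuts and for rules that keep the process up to `≡`. -/
theorem Typed.progress {n d : ℕ} {Ω : AccEnv W d} {Γ Δ : Ctx W L n d} {P : Proc W L n d}
    {z : Fin n} {C : Ty W L d} {ω : Dom W d} (h : Typed Ω Γ Δ P z C ω) : Progress Γ Δ P z C := by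
  induction h with
  | struct h _ ih => exact ih.congr h
  | id hxz =>
    refine .idle (fun h => h) (fun y hy => ?_) (.inr ⟨_, hxz, .inr ⟨rfl, rfl⟩⟩)
    obtain rfl := Multiset.mem_singleton.1 hy
    exact .inr ⟨_, hxz.symm, .inl ⟨rfl, rfl⟩⟩
  | oneR => exact .idle (fun h => h) (fun y hy => (Multiset.notMem_zero y hy).elim) (.inl rfl)
  | oneL _ ih => exact ih.cons_one
  | lolliR => exact .provide .inp (.inp _ _) .lolli
  | lolliL => exact .use .out (Prefixed.out _ _ _) .lolli
  | tensorR => exact .provide .out (Prefixed.out _ _ _) .tensor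
  | tensorL => exact .use .inp (.inp _ _) .tensor
  | @ampR _ _ _ _ _ I => exact .provide (.case I) (.case _ _ _) (.amp _)
  | @ampL₁ _ _ _ _ _ l => exact .use (.sel l) (.sel _ _ _) (.amp _ _ (Finset.mem_singleton_self l))
  | ampL₂ _ ih =>
    refine ih.mono_head (fun a ha => ?_) (fun h => by cases h)
    cases ha with
    | amp _ l hl => exact .amp _ _ (Finset.mem_cons_of_mem hl)
  | @plusR₁ _ _ _ _ _ l =>
    exact .provide (.sel l) (.sel _ _ _) (.plus _ _ (Finset.mem_singleton_self l))
  | plusR₂ _ ih =>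
    refine ih.mono_type (fun a ha => ?_) (fun h => by cases h)
    cases ha with
    | plus _ l hl => exact .plus _ _ (Finset.mem_cons_of_mem hl)
  | @plusL _ _ _ _ _ I => exact .use (.case I) (.case _ _ _) (.plus _)
  | bangR => exact .provide .out (Prefixed.out _ _ _) .bang
  | bangL => exact .use .inp (.inp _ _) .bang
  | atR => exact .provide .outAt (Prefixed.outAt _ _ _ _) .at_
  | atL => exact .use .inpAt (.inpAt _ _ _) .at_
  | allR => exact .provide .inpDom (.inpDom _ _) .all
  | allL => exact .use .outDom (.outDom _ _ _) .all
  | exR => exact .provide .outDom (.outDom _ _ _) .ex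
  | exL => exact .use .inpDom (.inpDom _ _) .ex
  | hereR _ ih =>
    exact ih.mono_type (fun a ha => by rwa [Ty.inst, Ty.shape_subst] at ha)
      (fun h => by rwa [Ty.inst, Ty.shape_subst] at h)
  | hereL _ ih =>
    exact ih.mono_head (fun a ha => by rwa [Ty.inst, Ty.shape_subst] at ha)
      (fun h => by rwa [Ty.inst, Ty.shape_subst] at h)
  | copy _ hu => exact .act _ .out (Prefixed.out _ _ _) (.copy _ hu)
  | cut _ _ _ _ ihP ihQ => exact ihP.cut ihQ
  | cutBang _ _ _ ihQ => exact ihQ.cutBang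

end DomainSession

theorem mainTheorem2 {W : Type*} {L : Type*} {n d : ℕ}
    (Ω : DomainSession.AccEnv W d) (P : DomainSession.Proc W L n d) (x : Fin n)
    (ω : DomainSession.Dom W d)
    (hP : DomainSession.Typed Ω 0 0 P x .one ω) (hlive : DomainSession.Live P) :
    ∃ Q : DomainSession.Proc W L n d, DomainSession.Red P Q := by
  rcases hP.progress with h | ⟨_, _, _, ha⟩ | ⟨h, _, _⟩
  · exact h
  · rcases ha with ha | ⟨y, hy, _⟩ | ⟨y, hy⟩
    -- A provider of `𝟏` has no prescribed action, and the empty environments prescribe none either.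
    · cases ha
    · exact (Multiset.notMem_zero y hy).elim
    · exact (Multiset.notMem_zero y hy).elim
  · exact (h hlive.hasPrefix).elim
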